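/- Let $\Omega$ be the space of locally finite integer-valued Borel measures on $\mathbb R$ (point configurations on the $y$-axis of $\mathbb R^2$), with the $\sigma$-field generated by the maps $\omega\mapsto\omega(B)$, $B\subset\mathbb R$ Borel. Let $N$ be the identity map on $\Omega$, and let the translations $x=(x_1,x_2)\in\mathbb R^2$ act on $\Omega$ by the flow $\theta_x\omega=\omega(x_2+\cdot)$. There exists a probability measure $\mathbb P$ on $\Omega$ under which $N$ is a stationary Poisson process with intensity $1$ (the canonical Poisson process: $N$ is the only source of randomness). For every such $\mathbb P$, let $\xi$ be the random measure on $\mathbb R^2$ formed by one-dimensional Lebesgue measure on the horizontal lines through the points of $N$, that is, $\xi(C)=\int \lambda_1(\{t:(t,y)\in C\})\,N(dy)$ for Borel $C\subset\mathbb R^2$, and let $\eta=\lambda_2$ be Lebesgue measure on $\mathbb R^2$. Then: 1. $\theta$ is a measurable flow, and $\mathbb P$ is stationary and ergodic under $\theta$. The maps $\xi$ and $\eta$ are random measures (measurable in $\omega$ and a.s. finite on compact sets) and are adapted to the flow: for $\mathbb P$-a.e. $\omega$, $\xi(\theta_x\omega,C-x)=\xi(\omega,C)$ for all $x\in\mathbb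 R^2$ and all Borel $C$, and likewise for $\eta$. In particular $\xi$ and $\eta$ are jointly stationary, $(\xi(x+\cdot),\eta(x+\cdot))\overset{D}{=}(\xi,\eta)$ for all $x\in\mathbb R^2$, and jointly ergodic: the distribution of $(\xi,\eta)$ takes only the values $0$ and $1$ on translation invariant measurable sets. 2. $\xi$ and $\eta$ are diffuse (a.s. without atoms), and both have intensity $1$: $\mathbb E\,\xi([0,1]^2)=\mathbb E\,\eta([0,1]^2)=1$. 3. There is no allocation on $\Omega$ balancing $\xi$ and $\eta$. That is, there is no measurable map $\tau:\Omega\times\mathbb R^2\to\mathbb R^2\cup\{\infty\}$ with the following two properties: for $\mathbb P$-a.e. $\omega$, $\tau(\theta_y\omega,x-y)=\tau(\omega,x)-y$ for all $x,y\in\mathbb R^2$ (where $\infty-y=\infty$); and for $\mathbb P$-a.e. $\omega$, $\xi(\omega,\{s:\tau(\omega,s)=\infty\})=0$ and $\xi(\omega,\{s:\tau(\omega,s)\in C\})=\eta(\omega,C)$ for all Borel $C\subset\mathbb R^2$. -/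

import Mathlib

open MeasureTheory ProbabilityTheory
open scoped ENNReal

noncomputable section

namespace BalancingAllocation

/-! ### Random measures, flows and allocations on `ℝ^d` -/

/-- The translate `θ_x μ = μ(x + ·)` of a measure `μ` on `ℝ^d`. -/
def shift {d : ℕ} (x : Fin d → ℝ) (μ : Measure (Fin d → ℝ)) : Measure (Fin d → ℝ) :=
  μ.map (fun z => z - x)

section Framework

variable {Ω : Type*} [MeasurableSpace Ω] {d : ℕ}

/-- A measurable flow `θ_x : Ω → Ω`, `x ∈ ℝ^d`. -/
structure IsMeasurableFlow (θ : (Fin d → ℝ) → Ω → Ω) : Prop where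
  measurable : Measurable (fun p : Ω × (Fin d → ℝ) => θ p.2 p.1)
  zero : ∀ ω, θ 0 ω = ω
  add : ∀ x y ω, θ x (θ y ω) = θ (x + y) ω

/-- The measure `P` on `Ω` is stationary under the flow `θ`. -/
def IsStationaryProb (P : Measure Ω) (θ : (Fin d → ℝ) → Ω → Ω) : Prop :=
  ∀ x, MeasurePreserving (θ x) P P

/-- The probability measure `P` is ergodic: flow-invariant events have probability `0` or `1`. -/
def IsErgodicProb (P : Measure Ω) (θ : (Fin d → ℝ) → Ω → Ω) : Prop :=
  ∀ A : Set Ω, MeasurableSet A → (∀ x, θ x '' A = A) → P A = 0 ∨ P A = 1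

/-- A random measure on `ℝ^d`: a kernel that is a.s. finite on compact sets. -/
structure IsRandomMeasure (P : Measure Ω) (ξ : Ω → Measure (Fin d → ℝ)) : Prop where
  measurable : Measurable ξ
  finite_on_compact : ∀ᵐ ω ∂P, ∀ K, IsCompact K → ξ ω K < ∞

/-- Stationarity (flow-adaptedness) of a random measure: a.s.
`ξ(θ_x ω, C - x) = ξ(ω, C)` for all `x` and all Borel sets `C`. -/
def IsStationaryRM (P : Measure Ω) (θ : (Fin d → ℝ) → Ω → Ω)
    (ξ : Ω → Measure (Fin d → ℝ)) : Prop :=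
  ∀ᵐ ω ∂P, ∀ x, ξ (θ x ω) = shift x (ξ ω)

/-- A random measure is diffuse if a.s. it has no atoms. -/
def IsDiffuse (P : Measure Ω) (ξ : Ω → Measure (Fin d → ℝ)) : Prop :=
  ∀ᵐ ω ∂P, ∀ x, ξ ω {x} = 0

/-- The intensity `E ξ([0,1]^d)`. -/
def intensity (P : Measure Ω) (ξ : Ω → Measure (Fin d → ℝ)) : ℝ≥0∞ :=
  ∫⁻ ω, ξ ω (Set.Icc 0 1) ∂P

/-- Joint stationarity in law: `(θ_x ξ, θ_x η)` has the same distribution as `(ξ, η)`. -/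
def JointlyStationary (P : Measure Ω) (ξ η : Ω → Measure (Fin d → ℝ)) : Prop :=
  ∀ x, IdentDistrib (fun ω => (shift x (ξ ω), shift x (η ω))) (fun ω => (ξ ω, η ω)) P P

/-- Joint ergodicity in law: the distribution of `(ξ, η)` takes only the values `0` and `1`
on translation invariant measurable sets of pairs of measures. -/
def JointlyErgodic (P : Measure Ω) (ξ η : Ω → Measure (Fin d → ℝ)) : Prop :=
  ∀ A : Set (Measure (Fin d → ℝ) × Measure (Fin d → ℝ)), MeasurableSet A →
    (∀ x, (fun m => (shift x m.1, shift x m.2)) '' A = A) →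
    P {ω | (ξ ω, η ω) ∈ A} = 0 ∨ P {ω | (ξ ω, η ω) ∈ A} = 1

/-- An allocation: a measurable map `τ : Ω × ℝ^d → ℝ^d ∪ {∞}` such that for a.e. `ω`
`τ(θ_y ω, x - y) = τ(ω, x) - y` for all `x, y`, where `∞ - y = ∞`. -/
structure IsAllocation (P : Measure Ω) (θ : (Fin d → ℝ) → Ω → Ω)
    (τ : Ω → (Fin d → ℝ) → OnePoint (Fin d → ℝ)) : Prop where
  measurable : Measurable[inferInstance, borel (OnePoint (Fin d → ℝ))]
    (fun p : Ω × (Fin d → ℝ) => τ p.1 p.2)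
  equivariant : ∀ᵐ ω ∂P, ∀ x y, τ (θ y ω) (x - y) = (τ ω x).map (fun z => z - y)

/-- The allocation `τ` balances `ξ` and `η`: a.s. `τ` is finite `ξ`-almost everywhere and the
image of `ξ` under `τ` is `η`. -/
structure Balances (P : Measure Ω) (τ : Ω → (Fin d → ℝ) → OnePoint (Fin d → ℝ))
    (ξ η : Ω → Measure (Fin d → ℝ)) : Prop where
  finite : ∀ᵐ ω ∂P, ξ ω {s | τ ω s = OnePoint.infty} = 0
  image : ∀ᵐ ω ∂P, ∀ C : Set (Fin d → ℝ), MeasurableSet C →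
    ξ ω {s | ∃ z ∈ C, τ ω s = (z : OnePoint (Fin d → ℝ))} = η ω C

end Framework

/-! ### The canonical Poisson process -/

/-- `N` is a Poisson process with (σ-finite) intensity measure `Λ` under the probability
measure `P`: counts are Poisson distributed and counts in disjoint sets are independent. -/
structure IsPoissonProcess {Ω X : Type*} [MeasurableSpace Ω] [MeasurableSpace X]
    (P : Measure Ω) (N : Ω → Measure X) (Λ : Measure X) : Prop where
  isProbabilityMeasure : IsProbabilityMeasure P
  measurable : Measurable N
  poisson : ∀ B, MeasurableSet B → Λ B < ∞ →
    P.map (fun ω => N ω B) = (poissonMeasure (Λ B).toNNReal).map (fun n : ℕ => (n : ℝ≥0∞))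
  indep : ∀ (m : ℕ) (B : Fin m → Set X), (∀ i, MeasurableSet (B i)) →
    Pairwise (fun i j => Disjoint (B i) (B j)) → iIndepFun (fun i ω => N ω (B i)) P

/-- The canonical space of point configurations on the line (the `y`-axis): locally finite
integer-valued measures, with the σ-algebra generated by the counts `ω ↦ ω B`. -/
abbrev Config : Type :=
  {μ : Measure ℝ // (∀ K, IsCompact K → μ K < ∞) ∧
    ∀ B, MeasurableSet B → ∃ n : ℕ∞, μ B = (n : ℝ≥0∞)}

/-- The canonical process: the identity on configurations. -/
def canonicalN (ω : Config) : Measure ℝ := ω.1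

/-- The configuration seen from height `b`: every point `y` is moved to `y - b`. -/
def Config.translate (b : ℝ) (ω : Config) : Config :=
  ⟨ω.1.map (fun y => y - b), by
    have hm : Measurable (fun y : ℝ => y - b) := measurable_id.sub_const b
    refine ⟨fun K hK => ?_, fun B hB => ?_⟩
    · rw [Measure.map_apply hm hK.measurableSet]
      exact ω.2.1 _ ((Homeomorph.subRight b).isCompact_preimage.2 hK)
    · rw [Measure.map_apply hm hB]
      exact ω.2.2 _ (hm hB)⟩

/-- The flow of translations of the plane acting on configurations on the `y`-axis:
`(a, b)` acts through its vertical component. -/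
def planeFlow (x : Fin 2 → ℝ) (ω : Config) : Config := ω.translate (x 1)

/-- One-dimensional Lebesgue measure on the horizontal line at height `y` in the plane. -/
def lineMeasure (y : ℝ) : Measure (Fin 2 → ℝ) :=
  (volume : Measure ℝ).map (fun t => ![t, y])

/-- The source `ξ`: the sum over the points `y` of the configuration `N` of the Lebesgue measures
on the horizontal lines at height `y`, i.e. the mixture `∫ lineMeasure y N(dy)`. -/
def lineField (ω : Config) : Measure (Fin 2 → ℝ) := (canonicalN ω).bind lineMeasure

/-- The destination `η`: Lebesgue measure on the plane. -/
def lebesgueField (_ω : Config) : Measure (Fin 2 → ℝ) := volume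

end BalancingAllocation

end

open MeasureTheory ProbabilityTheory
open scoped ENNReal

noncomputable section

/-! Non-existence is a deterministic argument. A horizontal translation of the plane acts trivially
on configurations, so equivariance makes an allocation commute with all horizontal translations: `τ
ω s` has a height that depends only on the height of `s`. The source `ξ` lives on countably many
horizontal lines, hence up to a `ξ`-null set its image lies on countably many horizontal lines.
Their union is Lebesgue null, so the image cannot be `η`. See `not_exists_balancing_allocation`,
with `Config.exists_countable_carrier` and `lineField_box`.

Stationarity follows from uniqueness in law: a translated Poisson process is again Poisson with
Lebesgue intensity, and `IsPoissonProcess.eq_of_canonical` identifies the two laws. Ergodicity is a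
mixing argument: events depending on a bounded window are independent of distant translates, and
they approximate every event, so an invariant event satisfies `P A = P A ^ 2`
(`isErgodicProb_planeFlow`). The joint statements for `ξ` and `η` are transported from the
configurations by the equivariance `lineField_planeFlow`.

Existence of the Poisson process is by construction: a Poisson number of i.i.d. points in each unit
interval (`isPoissonProcess_sample`), superposed over the integers
(`isPoissonProcess_superposition`). Both steps are computations with characteristic functions. -/

namespace BalancingAllocation

/-! ### Atoms of a finite family of sets -/

section Atoms

variable {X ι : Type*}

/-- The points of `W` that lie in exactly those sets `B i` with `i ∈ s`. -/
def atomOf (W : Set X) (B : ι → Set X) (s : Finset ι) : Set X :=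
  {x | x ∈ W ∧ ∀ i, x ∈ B i ↔ i ∈ s}

lemma atomOf_subset (W : Set X) (B : ι → Set X) (s : Finset ι) : atomOf W B s ⊆ W :=
  fun _ hx => hx.1

lemma disjoint_atomOf (W : Set X) (B : ι → Set X) :
    Pairwise (fun s t => Disjoint (atomOf W B s) (atomOf W B t)) := by
  intro s t hst
  rw [Set.disjoint_left]
  intro x hx hy
  exact hst (Finset.ext fun i => (hx.2 i).symm.trans (hy.2 i))

lemma measurableSet_atomOf [Finite ι] [MeasurableSpace X] {W : Set X} (hW : MeasurableSet W)
    {B : ι → Set X} (hB : ∀ i, MeasurableSet (B i)) (s : Finset ι) :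
    MeasurableSet (atomOf W B s) := by
  have : atomOf W B s = W ∩ ⋂ i, {x | x ∈ B i ↔ i ∈ s} := by
    ext x; simp [atomOf]
  rw [this]
  refine hW.inter (MeasurableSet.iInter fun i => ?_)
  exact (hB i).iff (MeasurableSet.const _)

open Classical in
/-- The counts of the sets `B i` in terms of the counts of their atoms. -/
def atomSum [Fintype ι] (c : Finset ι → ℝ≥0∞) (i : ι) : ℝ≥0∞ :=
  ∑ s : Finset ι, if i ∈ s then c s else 0

lemma measurable_atomSum [Fintype ι] : Measurable (atomSum : (Finset ι → ℝ≥0∞) → ι → ℝ≥0∞) := by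
  classical
  refine measurable_pi_lambda _ fun i => Finset.measurable_sum _ fun s _ => ?_
  split_ifs <;> fun_prop

lemma measure_inter_eq_atomSum [Fintype ι] [MeasurableSpace X] (μ : Measure X) {W : Set X}
    (hW : MeasurableSet W) {B : ι → Set X} (hB : ∀ i, MeasurableSet (B i)) (i : ι) :
    μ (B i ∩ W) = atomSum (fun s => μ (atomOf W B s)) i := by
  classical
  unfold atomSum
  rw [← Finset.sum_filter, ← measure_biUnion_finset
    (fun s _ t _ hst => disjoint_atomOf W B hst) (fun s _ => measurableSet_atomOf hW hB s)]
  congr 1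
  ext x
  simp only [Set.mem_inter_iff, Finset.mem_filter, Finset.mem_univ, true_and, Set.mem_iUnion,
    atomOf, Set.mem_ofPred_eq, exists_prop]
  constructor
  · rintro ⟨h1, h2⟩
    exact ⟨Finset.univ.filter fun j => x ∈ B j, by simpa using h1, h2, by simp⟩
  · rintro ⟨s, hs, h1, h2⟩
    exact ⟨(h2 i).2 hs, h1⟩

end Atoms

lemma iIndepFun_map_iff {Ω Ω' ι β : Type*} [MeasurableSpace Ω] [MeasurableSpace Ω'] [Finite ι]
    [MeasurableSpace β] {P : Measure Ω} [IsProbabilityMeasure P] {f : ι → Ω' → β}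
    (hf : ∀ i, Measurable (f i)) {g : Ω → Ω'} (hg : Measurable g) :
    iIndepFun f (P.map g) ↔ iIndepFun (fun i ω => f i (g ω)) P := by
  have := Fintype.ofFinite ι
  have := Measure.isProbabilityMeasure_map (μ := P) hg.aemeasurable
  rw [iIndepFun_iff_map_fun_eq_pi_map fun i => (hf i).aemeasurable,
    iIndepFun_iff_map_fun_eq_pi_map (f := fun i ω => f i (g ω))
      fun i => ((hf i).comp hg).aemeasurable,
    Measure.map_map (measurable_pi_lambda _ hf) hg]
  simp_rw [Measure.map_map (hf _) hg]
  rfl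

/-! ### Laws and independence of Poisson counts -/

namespace IsPoissonProcess

variable {Ω X : Type*} [MeasurableSpace Ω] [MeasurableSpace X] {P : Measure Ω}
  {N : Ω → Measure X} {Λ : Measure X}

lemma measurable_restrict (h : IsPoissonProcess P N Λ) {W : Set X} (hW : MeasurableSet W) :
    Measurable fun ω => (N ω).restrict W := by
  refine Measure.measurable_of_measurable_coe _ fun B hB => ?_
  simp only [Measure.restrict_apply hB]
  exact (Measure.measurable_coe (hB.inter hW)).comp h.measurable

lemma measurable_count (h : IsPoissonProcess P N Λ) {B : Set X} (hB : MeasurableSet B) :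
    Measurable fun ω => N ω B :=
  (Measure.measurable_coe hB).comp h.measurable

lemma indep_of_finite (h : IsPoissonProcess P N Λ) {ι : Type*} [Finite ι] {B : ι → Set X}
    (hB : ∀ i, MeasurableSet (B i)) (hd : Pairwise (fun i j => Disjoint (B i) (B j))) :
    iIndepFun (fun i ω => N ω (B i)) P := by
  obtain ⟨m, ⟨e⟩⟩ := Finite.exists_equiv_fin ι
  exact (h.indep m (fun k => B (e.symm k)) (fun k => hB _)
    (fun a b hab => hd (e.symm.injective.ne hab))).of_precomp e.symm.surjective

lemma map_counts_of_disjoint (h : IsPoissonProcess P N Λ) {ι : Type*} [Fintype ι] {B : ι → Set X}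
    (hB : ∀ i, MeasurableSet (B i)) (hd : Pairwise (fun i j => Disjoint (B i) (B j)))
    (hf : ∀ i, Λ (B i) < ∞) :
    P.map (fun ω i => N ω (B i)) = Measure.pi fun i =>
      (poissonMeasure (Λ (B i)).toNNReal).map (fun n : ℕ => (n : ℝ≥0∞)) := by
  have := h.isProbabilityMeasure
  rw [(iIndepFun_iff_map_fun_eq_pi_map
    fun i => (h.measurable_count (hB i)).aemeasurable).1 (h.indep_of_finite hB hd)]
  congr 1
  ext1 i
  exact h.poisson _ (hB i) (hf i)

/-- The finite-dimensional distributions of a Poisson process are determined by its intensity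
measure. -/
lemma map_counts_eq {Ω' : Type*} [MeasurableSpace Ω'] {P' : Measure Ω'} {N' : Ω' → Measure X}
    (h : IsPoissonProcess P N Λ) (h' : IsPoissonProcess P' N' Λ) {ι : Type*} [Finite ι]
    {B : ι → Set X} (hB : ∀ i, MeasurableSet (B i)) (hf : ∀ i, Λ (B i) < ∞) :
    P.map (fun ω i => N ω (B i)) = P'.map (fun ω i => N' ω (B i)) := by
  classical
  have := Fintype.ofFinite ι
  set W := ⋃ i, B i
  have hW : MeasurableSet W := MeasurableSet.iUnion hB
  have hWf : Λ W < ∞ := (measure_iUnion_fintype_le _ _).trans_lt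
    (by simpa [ENNReal.sum_lt_top] using hf)
  -- The sets `B i` may overlap, but their atoms are disjoint with finite intensity, so the atom
  -- counts have a known product law. The counts of the `B i` are one fixed measurable function of
  -- them.
  have key : ∀ μ : Measure X, (fun i => μ (B i)) = atomSum (fun s => μ (atomOf W B s)) := by
    intro μ
    ext i
    rw [← measure_inter_eq_atomSum μ hW hB i, Set.inter_eq_left.2 (Set.subset_iUnion B i)]
  have hA := fun s => measurableSet_atomOf hW hB s
  have hAf : ∀ s, Λ (atomOf W B s) < ∞ :=
    fun s => (measure_mono (atomOf_subset W B s)).trans_lt hWf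
  have hg := measurable_atomSum (ι := ι)
  have e1 : P.map (fun ω => atomSum fun s => N ω (atomOf W B s)) =
      (P.map (fun ω s => N ω (atomOf W B s))).map atomSum :=
    (Measure.map_map hg (measurable_pi_lambda _ fun s => h.measurable_count (hA s))).symm
  have e2 : P'.map (fun ω => atomSum fun s => N' ω (atomOf W B s)) =
      (P'.map (fun ω s => N' ω (atomOf W B s))).map atomSum :=
    (Measure.map_map hg (measurable_pi_lambda _ fun s => h'.measurable_count (hA s))).symm
  rw [funext fun ω => key (N ω), funext fun ω => key (N' ω), e1, e2,
    h.map_counts_of_disjoint hA (disjoint_atomOf W B) hAf,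
    h'.map_counts_of_disjoint hA (disjoint_atomOf W B) hAf]

/-- A measurable image of a Poisson process is a Poisson process. -/
lemma map_space {Y : Type*} [MeasurableSpace Y] (h : IsPoissonProcess P N Λ) {f : X → Y}
    (hf : Measurable f) : IsPoissonProcess P (fun ω => (N ω).map f) (Λ.map f) where
  isProbabilityMeasure := h.isProbabilityMeasure
  measurable := (Measure.measurable_map f hf).comp h.measurable
  poisson B hB hΛ := by
    rw [Measure.map_apply hf hB] at hΛ ⊢
    simp only [Measure.map_apply hf hB]
    exact h.poisson _ (hf hB) hΛ
  indep m B hB hd := by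
    simp only [fun i ω => Measure.map_apply (μ := N ω) hf (hB i)]
    exact h.indep m _ (fun i => hf (hB i)) fun i j hij => (hd hij).preimage f

/-- Being a Poisson process is a property of the law. -/
lemma map_prob {Ω' : Type*} [MeasurableSpace Ω'] {F : Ω → Ω'} (hF : Measurable F)
    {N' : Ω' → Measure X} (hN' : Measurable N') (h : IsPoissonProcess P (fun ω => N' (F ω)) Λ) :
    IsPoissonProcess (P.map F) N' Λ where
  isProbabilityMeasure :=
    have := h.isProbabilityMeasure
    Measure.isProbabilityMeasure_map hF.aemeasurable
  measurable := hN'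
  poisson B hB hΛ := by
    rw [Measure.map_map (g := fun ω => N' ω B) ((Measure.measurable_coe hB).comp hN') hF]
    exact h.poisson B hB hΛ
  indep m B hB hd := by
    have hm : ∀ i, Measurable fun ω => N' ω (B i) :=
      fun i => (Measure.measurable_coe (hB i)).comp hN'
    have := h.isProbabilityMeasure
    exact (iIndepFun_map_iff hm hF).2 (h.indep m B hB hd)

/-- The restrictions of a Poisson process to disjoint sets are independent. -/
lemma indepFun_restrict (h : IsPoissonProcess P N Λ) {W W' : Set X} (hW : MeasurableSet W)
    (hW' : MeasurableSet W') (hd : Disjoint W W') :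
    IndepFun (fun ω => (N ω).restrict W) (fun ω => (N ω).restrict W') P := by
  classical
  have := h.isProbabilityMeasure
  let S := {B : Set X // MeasurableSet B}
  have hproc : IndepFun (fun ω (B : S) => (N ω).restrict W B) (fun ω (B : S) =>
      (N ω).restrict W' B) P := by
    refine IndepFun.process_indepFun_process
      (fun B => (Measure.measurable_coe B.2).comp (h.measurable_restrict hW))
      (fun B => (Measure.measurable_coe B.2).comp (h.measurable_restrict hW')) fun I J => ?_
    -- The atoms inside `W` and those inside `W'` together form one disjoint family, to which
    -- independence of counts applies.
    let C : Finset I ⊕ Finset J → Set X :=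
      Sum.elim (atomOf W fun i : I => i.1.1) (atomOf W' fun j : J => j.1.1)
    have hC : ∀ a, MeasurableSet (C a) := by
      rintro (s | s)
      · exact measurableSet_atomOf hW (fun i => i.1.2) s
      · exact measurableSet_atomOf hW' (fun i => i.1.2) s
    have hCd : Pairwise (fun a b => Disjoint (C a) (C b)) := by
      rintro (s | s) (t | t) hst
      · exact disjoint_atomOf _ _ fun h => hst (h ▸ rfl)
      · exact hd.mono (atomOf_subset _ _ _) (atomOf_subset _ _ _)
      · exact hd.symm.mono (atomOf_subset _ _ _) (atomOf_subset _ _ _)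
      · exact disjoint_atomOf _ _ fun h => hst (h ▸ rfl)
    have hi := (h.indep_of_finite hC hCd).indepFun_finset
      (Finset.univ.map Function.Embedding.inl) (Finset.univ.map Function.Embedding.inr)
      (by simp [Finset.disjoint_left]) fun a => h.measurable_count (hC a)
    have hi' := hi.comp
      (φ := fun c => atomSum fun s : Finset I => c ⟨Sum.inl s, by simp⟩)
      (ψ := fun c => atomSum fun s : Finset J => c ⟨Sum.inr s, by simp⟩)
      (measurable_atomSum.comp (measurable_pi_lambda _ fun s => measurable_pi_apply _))
      (measurable_atomSum.comp (measurable_pi_lambda _ fun s => measurable_pi_apply _))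
    convert hi' using 1
    · ext ω i
      rw [Measure.restrict_apply i.1.2]
      exact measure_inter_eq_atomSum (N ω) hW (B := fun i : I => i.1.1) (fun i => i.1.2) i
    · ext ω i
      rw [Measure.restrict_apply i.1.2]
      exact measure_inter_eq_atomSum (N ω) hW' (B := fun i : J => i.1.1) (fun i => i.1.2) i
  -- The σ-algebra on measures is generated by evaluations, so a restriction carries no more
  -- information than its family of counts.
  have hle : ∀ V : Set X, MeasurableSpace.comap (fun ω => (N ω).restrict V) inferInstance ≤
      MeasurableSpace.comap (fun ω (B : S) => (N ω).restrict V B) inferInstance := by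
    intro V
    rw [← measurable_iff_comap_le]
    refine @Measure.measurable_of_measurable_coe _ _ _ (MeasurableSpace.comap _ _) _ fun B hB => ?_
    exact (measurable_pi_apply (⟨B, hB⟩ : S)).comp
      (comap_measurable (fun ω (B : S) => (N ω).restrict V B))
  rw [IndepFun_iff_Indep] at hproc ⊢
  exact indep_of_indep_of_le_left (indep_of_indep_of_le_right hproc (hle W')) (hle W)

end IsPoissonProcess

lemma abs_measureReal_sub_le_symmDiff {Ω : Type*} [MeasurableSpace Ω] (P : Measure Ω)
    [IsFiniteMeasure P] (s t : Set Ω) : |P.real s - P.real t| ≤ P.real (symmDiff s t) := by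
  have key : ∀ u v : Set Ω, P.real u ≤ P.real v + P.real (symmDiff u v) := fun u v =>
    (measureReal_mono fun ω => by
      simp only [Set.mem_symmDiff, Set.mem_union]; tauto).trans (measureReal_union_le v _)
  have h1 := key s t
  have h2 := key t s
  rw [symmDiff_comm] at h2
  exact abs_le.2 ⟨by linarith, by linarith⟩

/-! ### Uniqueness of the canonical law and stationarity -/

/-- The symmetric window `[-n, n]`. -/
def window (n : ℕ) : Set ℝ := Set.Icc (-(n : ℝ)) n

lemma measurableSet_window (n : ℕ) : MeasurableSet (window n) := measurableSet_Icc

lemma monotone_window : Monotone window := fun _ _ h =>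
  Set.Icc_subset_Icc (neg_le_neg (Nat.cast_le.2 h)) (Nat.cast_le.2 h)

lemma iUnion_window : ⋃ n, window n = Set.univ := by
  rw [Set.eq_univ_iff_forall]
  intro x
  obtain ⟨n, hn⟩ := exists_nat_ge |x|
  exact Set.mem_iUnion.2 ⟨n, abs_le.1 hn⟩

lemma measure_eq_iSup_window (μ : Measure ℝ) (B : Set ℝ) : μ B = ⨆ n, μ (B ∩ window n) := by
  rw [← Monotone.measure_iUnion fun m n h => Set.inter_subset_inter_right B (monotone_window h),
    ← Set.inter_iUnion, iUnion_window, Set.inter_univ]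

/-- Monotone convergence along the windows reduces measurability to counts of bounded sets, which
have finite intensity and are local. -/
lemma measurable_config_of_window {Ω : Type*} [MeasurableSpace Ω] {f : Ω → Config}
    (h : ∀ n B, MeasurableSet B → B ⊆ window n → Measurable fun ω => (f ω).1 B) :
    Measurable f := by
  have : Measurable fun ω => (f ω).1 := by
    refine Measure.measurable_of_measurable_coe _ fun B hB => ?_
    simp only [fun ω => measure_eq_iSup_window (f ω).1 B]
    exact Measurable.iSup fun n => h n _ (hB.inter (measurableSet_window n)) Set.inter_subset_right
  exact this.subtype_mk

lemma measurable_canonicalN : Measurable canonicalN := measurable_subtype_coe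

lemma Config.measurable_translate (b : ℝ) : Measurable (Config.translate b) :=
  Measurable.subtype_mk ((Measure.measurable_map _ (measurable_id.sub_const b)).comp
    measurable_subtype_coe)

lemma Config.translate_zero (ω : Config) : ω.translate 0 = ω := by
  apply Subtype.ext
  simp [Config.translate]

lemma Config.translate_translate (a b : ℝ) (ω : Config) :
    (ω.translate b).translate a = ω.translate (a + b) := by
  apply Subtype.ext
  simp only [Config.translate]
  rw [Measure.map_map (by fun_prop) (by fun_prop)]
  congr 1
  ext y
  simp only [Function.comp_apply]
  ring

/-- The canonical Poisson process has only one distribution. -/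
lemma IsPoissonProcess.eq_of_canonical {P Q : Measure Config}
    (hP : IsPoissonProcess P canonicalN volume) (hQ : IsPoissonProcess Q canonicalN volume) :
    P = Q := by
  have := hP.isProbabilityMeasure
  have := hQ.isProbabilityMeasure
  let S := {B : Set ℝ // MeasurableSet B ∧ volume B < ∞}
  let T : Config → S → ℝ≥0∞ := fun ω B => canonicalN ω B.1
  have hT : Measurable T := measurable_pi_lambda _ fun B => hP.measurable_count B.2.1
  have hle : (Subtype.instMeasurableSpace : MeasurableSpace Config) ≤ MeasurableSpace.comap T inferInstance := by
    have : @Measurable _ _ (MeasurableSpace.comap T inferInstance) Subtype.instMeasurableSpace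
        (id : Config → Config) := by
      refine @measurable_config_of_window _ (MeasurableSpace.comap T inferInstance) _
        fun n B hB hn => ?_
      exact (measurable_pi_apply (⟨B, hB, (measure_mono hn).trans_lt measure_Icc_lt_top⟩ : S)).comp
        (comap_measurable T)
    simpa using this.comap_le
  -- Both laws are projective limits of the same finite-dimensional distributions, and a projective
  -- limit of finite measures is unique.
  have hmap : P.map T = Q.map T := by
    have h1 := isProjectiveLimit_map (P := P) (X := fun (B : S) ω => canonicalN ω B.1)
      hT.aemeasurable
    have h2 := isProjectiveLimit_map (P := Q) (X := fun (B : S) ω => canonicalN ω B.1)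
      hT.aemeasurable
    have h3 : ∀ I : Finset S, P.map (fun ω => I.restrict fun B : S => canonicalN ω B.1) =
        Q.map (fun ω => I.restrict fun B : S => canonicalN ω B.1) := fun I =>
      hP.map_counts_eq hQ (ι := I) (B := fun B => B.1.1) (fun B => B.1.2.1) (fun B => B.1.2.2)
    have : ∀ I : Finset S, IsFiniteMeasure
        (P.map (fun ω => I.restrict fun B : S => canonicalN ω B.1)) := fun I => inferInstance
    refine IsProjectiveLimit.unique h1 ?_
    simp_rw [h3]
    exact h2
  ext A hA
  obtain ⟨A', hA', rfl⟩ := hle A hA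
  rw [← Measure.map_apply hT hA', hmap, Measure.map_apply hT hA']

lemma IsPoissonProcess.measurePreserving_translate {P : Measure Config}
    (hP : IsPoissonProcess P canonicalN volume) (b : ℝ) :
    MeasurePreserving (Config.translate b) P P := by
  refine ⟨Config.measurable_translate b, IsPoissonProcess.eq_of_canonical ?_ hP⟩
  refine IsPoissonProcess.map_prob (Config.measurable_translate b) measurable_canonicalN ?_
  have h := hP.map_space (f := fun y : ℝ => y - b) (measurable_id.sub_const b)
  rwa [(measurePreserving_sub_right volume b).map_eq] at h

lemma isStationaryProb_planeFlow {P : Measure Config}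
    (hP : IsPoissonProcess P canonicalN volume) : IsStationaryProb P planeFlow :=
  fun x => hP.measurePreserving_translate (x 1)

/-! ### Local events, mixing and ergodicity -/

/-- The events that only depend on the points in `window n`. -/
abbrev localEvents (n : ℕ) : MeasurableSpace Config :=
  MeasurableSpace.comap (fun ω => (canonicalN ω).restrict (window n)) inferInstance

lemma measurable_restrict_canonicalN {W : Set ℝ} (hW : MeasurableSet W) :
    Measurable fun ω => (canonicalN ω).restrict W := by
  refine Measure.measurable_of_measurable_coe _ fun B hB => ?_
  simp only [Measure.restrict_apply hB]
  exact (Measure.measurable_coe (hB.inter hW)).comp measurable_canonicalN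

lemma localEvents_le (n : ℕ) : localEvents n ≤ (Subtype.instMeasurableSpace : MeasurableSpace Config) :=
  (measurable_restrict_canonicalN (measurableSet_window n)).comap_le

lemma monotone_localEvents : Monotone localEvents := by
  intro m n h
  rw [localEvents, ← measurable_iff_comap_le]
  refine @Measure.measurable_of_measurable_coe _ _ _ (localEvents n) _ fun B hB => ?_
  have : (fun ω : Config => (canonicalN ω).restrict (window m) B) =
      fun ω => (canonicalN ω).restrict (window n) (B ∩ window m) := by
    ext ω
    rw [Measure.restrict_apply hB, Measure.restrict_apply (hB.inter (measurableSet_window m)),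
      Set.inter_assoc, Set.inter_eq_left.2 (monotone_window h)]
  rw [this]
  exact (Measure.measurable_coe (hB.inter (measurableSet_window m))).comp
    (comap_measurable (fun ω : Config => (canonicalN ω).restrict (window n)))

lemma isSetRing_localEvents : IsSetRing {A | ∃ n, MeasurableSet[localEvents n] A} where
  empty_mem := ⟨0, @MeasurableSet.empty _ (localEvents 0)⟩
  union_mem := by
    rintro s t ⟨m, hs⟩ ⟨n, ht⟩
    exact ⟨max m n, @MeasurableSet.union _ (localEvents (max m n)) _ _
      (monotone_localEvents (le_max_left m n) _ hs) (monotone_localEvents (le_max_right m n) _ ht)⟩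
  sdiff_mem := by
    rintro s t ⟨m, hs⟩ ⟨n, ht⟩
    exact ⟨max m n, @MeasurableSet.diff _ (localEvents (max m n)) _ _
      (monotone_localEvents (le_max_left m n) _ hs) (monotone_localEvents (le_max_right m n) _ ht)⟩

lemma generateFrom_localEvents : (Subtype.instMeasurableSpace : MeasurableSpace Config) =
    MeasurableSpace.generateFrom {A | ∃ n, MeasurableSet[localEvents n] A} := by
  refine le_antisymm ?_ (MeasurableSpace.generateFrom_le ?_)
  · let m := MeasurableSpace.generateFrom {A | ∃ n, MeasurableSet[localEvents n] A}
    have hle : ∀ n, localEvents n ≤ m :=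
      fun n A hA => MeasurableSpace.measurableSet_generateFrom ⟨n, hA⟩
    have : @Measurable _ _ m Subtype.instMeasurableSpace (id : Config → Config) := by
      refine @measurable_config_of_window _ m _ fun n B hB hn => ?_
      have e : (fun ω : Config => (id ω).1 B) =
          fun ω => (canonicalN ω).restrict (window n) B := by
        ext ω
        rw [Measure.restrict_apply hB, Set.inter_eq_left.2 hn]
        rfl
      rw [e]
      exact ((Measure.measurable_coe hB).comp
        (comap_measurable (fun ω : Config => (canonicalN ω).restrict (window n)))).mono
          (hle n) le_rfl
    exact MeasurableSpace.comap_id.symm.le.trans this.comap_le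
  · rintro A ⟨n, hA⟩
    exact localEvents_le n _ hA

/-- A local event is independent of its translate by a large distance. -/
lemma IsPoissonProcess.measure_inter_translate {P : Measure Config}
    (hP : IsPoissonProcess P canonicalN volume) {n : ℕ} {A : Set Config}
    (hA : MeasurableSet[localEvents n] A) :
    P (A ∩ Config.translate (2 * n + 1) ⁻¹' A) = P A * P A := by
  -- The preimage of `[-n, n]` under `y ↦ y - b` is `[n + 1, 3n + 1]`, which is disjoint from `[-n,
  -- n]`.
  set b : ℝ := 2 * n + 1 with hb
  have hAm := localEvents_le n _ hA
  obtain ⟨D, hD, rfl⟩ := hA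
  have hf : Measurable fun y : ℝ => y - b := measurable_id.sub_const b
  set W' := (fun y : ℝ => y - b) ⁻¹' window n with hW'
  have hind := hP.indepFun_restrict (measurableSet_window n) (hf (measurableSet_window n)) (by
    rw [Set.disjoint_left]
    intro y h1 h2
    have h1' := h1.2
    have h2' : -(n : ℝ) ≤ y - b := h2.1
    linarith)
  have e : Config.translate b ⁻¹' ((fun ω => (canonicalN ω).restrict (window n)) ⁻¹' D) =
      (fun ω => (canonicalN ω).restrict W') ⁻¹' ((fun μ => μ.map (fun y : ℝ => y - b)) ⁻¹' D) := by
    ext ω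
    simp only [Set.mem_preimage]
    rw [← Measure.restrict_map hf (measurableSet_window n)]
    rfl
  have hstat := (hP.measurePreserving_translate b).measure_preimage hAm.nullMeasurableSet
  rw [e] at hstat ⊢
  rw [hind.measure_inter_preimage_eq_mul _ _ hD (Measure.measurable_map _ hf hD), hstat]

lemma isErgodicProb_planeFlow {P : Measure Config}
    (hP : IsPoissonProcess P canonicalN volume) : IsErgodicProb P planeFlow := by
  have := hP.isProbabilityMeasure
  intro A hA hinv
  -- Invariance is given for images; the flow being invertible, it holds for preimages too.
  have hpre : ∀ b, Config.translate b ⁻¹' A = A := by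
    intro b
    have himg : ∀ c, Config.translate c '' A = A := fun c => hinv (fun _ => c)
    ext ω
    refine ⟨fun h => ?_, fun h => ?_⟩
    · rw [← himg (-b)]
      exact ⟨_, h, by rw [Config.translate_translate, neg_add_cancel, Config.translate_zero]⟩
    · rw [Set.mem_preimage, ← himg b]
      exact ⟨ω, h, rfl⟩
  -- With a local event `t` that is `ε`-close to `A`, `P t ^ 2 = P (t ∩ T⁻¹ t)` is within `2ε` of `P
  -- A` by invariance, and within `2ε` of `P A ^ 2` since probabilities are at most `1`.
  have hbound : ∀ ε : ℝ, 0 < ε → |P.real A - P.real A * P.real A| ≤ 4 * ε := by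
    intro ε hε
    obtain ⟨t, ⟨n, ht⟩, htA⟩ := exists_measure_symmDiff_lt_of_generateFrom_isSetRing
      (μ := P) isSetRing_localEvents
      ⟨{Set.univ}, Set.countable_singleton _, by
        rintro _ rfl; exact ⟨0, @MeasurableSet.univ _ (localEvents 0)⟩, by simp⟩
      generateFrom_localEvents hA (ENNReal.ofReal_pos.2 hε)
    have htm := localEvents_le n _ ht
    set T := Config.translate (2 * n + 1)
    have hTA : T ⁻¹' A = A := hpre _
    have h1 : P.real (symmDiff t A) ≤ ε :=
      ENNReal.toReal_le_of_le_ofReal hε.le htA.le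
    have h2 : P.real (symmDiff (T ⁻¹' t) A) ≤ ε := by
      have hT := (hP.measurePreserving_translate (2 * n + 1)).measureReal_preimage
        (htm.symmDiff hA).nullMeasurableSet
      rw [Set.preimage_symmDiff] at hT
      change P.real (symmDiff (T ⁻¹' t) (T ⁻¹' A)) = _ at hT
      rw [hTA] at hT
      exact hT.trans_le h1
    have h3 : P.real (symmDiff (t ∩ T ⁻¹' t) A) ≤ 2 * ε := by
      refine (measureReal_mono ?_).trans ((measureReal_union_le (symmDiff t A)
        (symmDiff (T ⁻¹' t) A)).trans (by linarith))
      intro ω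
      simp only [Set.mem_symmDiff, Set.mem_union, Set.mem_inter_iff]
      tauto
    have h4 : P.real (t ∩ T ⁻¹' t) = P.real t * P.real t := by
      simp only [measureReal_def, ← ENNReal.toReal_mul]
      rw [hP.measure_inter_translate ht]
    have h5 := (abs_measureReal_sub_le_symmDiff P t A).trans h1
    have h6 := (abs_measureReal_sub_le_symmDiff P (t ∩ T ⁻¹' t) A).trans h3
    rw [h4] at h6
    have ht1 : P.real t ≤ 1 := measureReal_le_one
    have hA1 : P.real A ≤ 1 := measureReal_le_one
    have ht0 : 0 ≤ P.real t := measureReal_nonneg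
    have hA0 : 0 ≤ P.real A := measureReal_nonneg
    have h7 : |P.real t * P.real t - P.real A * P.real A| ≤ 2 * ε := by
      have : P.real t * P.real t - P.real A * P.real A =
          (P.real t + P.real A) * (P.real t - P.real A) := by ring
      rw [this, abs_mul, abs_of_nonneg (add_nonneg ht0 hA0)]
      exact mul_le_mul (by linarith) h5 (abs_nonneg _) (by norm_num)
    rw [abs_le] at h6 h7 ⊢
    constructor <;> linarith [h6.1, h6.2, h7.1, h7.2]
  have hzero : P.real A - P.real A * P.real A = 0 := by
    rw [← abs_eq_zero]
    refine le_antisymm (le_of_forall_pos_le_add fun ε hε => ?_) (abs_nonneg _)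
    have := hbound (ε / 4) (by positivity)
    linarith
  have hcases : P.real A = 0 ∨ P.real A = 1 := by
    have : P.real A * (1 - P.real A) = 0 := by linarith
    rcases mul_eq_zero.1 this with h | h
    · exact Or.inl h
    · exact Or.inr (by linarith)
  refine hcases.imp (fun h => (measureReal_eq_zero_iff).1 h) fun h => ?_
  rw [← ENNReal.toReal_eq_one_iff]
  exact h

/-! ### Joint measurability of the flow -/

/-- The canonical process as a kernel. -/
def configKernel : Kernel Config ℝ := ⟨canonicalN, measurable_canonicalN⟩

lemma Config.measure_window_lt_top (ω : Config) (n : ℕ) : canonicalN ω (window n) < ∞ :=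
  ω.2.1 _ isCompact_Icc

lemma Config.exists_nat_eq (ω : Config) {B : Set ℝ} (hB : MeasurableSet B)
    (hf : canonicalN ω B ≠ ∞) : ∃ n : ℕ, canonicalN ω B = n := by
  obtain ⟨n, hn⟩ := ω.2.2 B hB
  have hn' : canonicalN ω B = n := hn
  rw [hn'] at hf ⊢
  lift n to ℕ using (by simpa using hf)
  exact ⟨n, by simp⟩

/-- S-finiteness makes integrals against the kernel measurable in parameters. The mass of a bounded
cell is finite but not bounded uniformly in `ω`, so configurations are also split by its integer
value `m`; each piece is then bounded by `m`. -/
instance : IsSFiniteKernel configKernel := by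
  classical
  let V : ℕ → Set ℝ := disjointed window
  have hV : ∀ n, MeasurableSet (V n) := MeasurableSet.disjointed measurableSet_window
  have hVf : ∀ ω n, canonicalN ω (V n) ≠ ∞ := fun ω n =>
    ((measure_mono (disjointed_subset _ n)).trans_lt (ω.measure_window_lt_top n)).ne
  have hs : ∀ p : ℕ × ℕ, MeasurableSet {ω : Config | canonicalN ω (V p.1) = p.2} := fun p =>
    ((Measure.measurable_coe (hV p.1)).comp measurable_canonicalN) (measurableSet_singleton _)
  let κ : ℕ × ℕ → Kernel Config ℝ := fun p =>
    Kernel.piecewise (hs p) (configKernel.restrict (hV p.1)) 0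
  have hκ : ∀ p ω, κ p ω = if canonicalN ω (V p.1) = p.2 then (canonicalN ω).restrict (V p.1)
      else 0 := by
    intro p ω
    simp only [κ, Kernel.piecewise_apply, Kernel.restrict_apply]
    rfl
  have hfin : ∀ p, IsFiniteKernel (κ p) := fun p => ⟨p.2, by simp, fun ω => by
    rw [hκ]
    split_ifs with h
    · rw [Measure.restrict_apply_univ, h]
    · simp⟩
  have hsum : configKernel = Kernel.sum κ := by
    ext ω B hB
    rw [Kernel.sum_apply' κ ω hB, ENNReal.tsum_prod']
    have h1 : ∀ n, ∑' m, κ (n, m) ω B = canonicalN ω (B ∩ V n) := by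
      intro n
      obtain ⟨m, hm⟩ := ω.exists_nat_eq (hV n) (hVf ω n)
      rw [tsum_eq_single m]
      · rw [hκ, if_pos hm, Measure.restrict_apply hB]
      · intro m' hm'
        rw [hκ, if_neg]
        · simp
        · rw [hm]
          exact fun h => hm' (Nat.cast_injective h).symm
    simp_rw [h1]
    rw [← measure_iUnion (fun i j hij => ((disjoint_disjointed window hij).mono
      Set.inter_subset_right Set.inter_subset_right)) (fun n => hB.inter (hV n)),
      ← Set.inter_iUnion, iUnion_disjointed, iUnion_window, Set.inter_univ]
    rfl
  rw [hsum]
  infer_instance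

lemma isMeasurableFlow_planeFlow : IsMeasurableFlow planeFlow where
  measurable := by
    refine measurable_config_of_window fun n B hB _ => ?_
    let κ : Kernel (Config × (Fin 2 → ℝ)) ℝ := configKernel.comap Prod.fst measurable_fst
    -- As a kernel integral of a function jointly measurable in all variables, the translated count
    -- is measurable in `ω` and `x` together.
    have e : (fun p : Config × (Fin 2 → ℝ) => (planeFlow p.2 p.1).1 B) =
        fun p : Config × (Fin 2 → ℝ) => ∫⁻ y, B.indicator 1 (y - p.2 1) ∂κ p := by
      ext p
      have hm : Measurable fun y : ℝ => y - p.2 1 := by fun_prop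
      have : (fun y : ℝ => B.indicator (1 : ℝ → ℝ≥0∞) (y - p.2 1)) =
          ((fun y : ℝ => y - p.2 1) ⁻¹' B).indicator 1 := rfl
      rw [this, lintegral_indicator_one (hm hB), Kernel.comap_apply]
      exact Measure.map_apply hm hB
    rw [e]
    refine Measurable.lintegral_kernel_prod_right ?_
    exact (measurable_one.indicator hB).comp
      (g := B.indicator (1 : ℝ → ℝ≥0∞)) (f := fun q : (Config × (Fin 2 → ℝ)) × ℝ => q.2 - q.1.2 1)
      (by fun_prop)
  zero ω := Config.translate_zero ω
  add x y ω := Config.translate_translate _ _ ω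

/-! ### The line field and the Lebesgue field -/

lemma measurable_lineMap (y : ℝ) : Measurable fun t : ℝ => ![t, y] := by
  refine measurable_pi_lambda _ fun i => ?_
  fin_cases i
  · exact measurable_id
  · exact measurable_const

lemma lineMeasure_apply (y : ℝ) {C : Set (Fin 2 → ℝ)} (hC : MeasurableSet C) :
    lineMeasure y C = volume {t : ℝ | ![t, y] ∈ C} :=
  Measure.map_apply (measurable_lineMap y) hC

lemma measurable_lineMeasure : Measurable lineMeasure := by
  refine Measure.measurable_of_measurable_coe _ fun C hC => ?_
  simp only [fun y => lineMeasure_apply y hC]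
  have hm : Measurable fun p : ℝ × ℝ => ![p.2, p.1] := by
    refine measurable_pi_lambda _ fun i => ?_
    fin_cases i
    · exact measurable_snd
    · exact measurable_fst
  exact measurable_measure_prodMk_left (hm hC)

lemma lineField_apply (ω : Config) {C : Set (Fin 2 → ℝ)} (hC : MeasurableSet C) :
    lineField ω C = ∫⁻ y, lineMeasure y C ∂canonicalN ω :=
  Measure.bind_apply hC measurable_lineMeasure.aemeasurable

lemma measurable_lineField : Measurable lineField :=
  (Measure.measurable_bind' measurable_lineMeasure).comp measurable_canonicalN

/-- The product set `S × T` in the plane `Fin 2 → ℝ`. -/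
def box (S T : Set ℝ) : Set (Fin 2 → ℝ) := {z | z 0 ∈ S ∧ z 1 ∈ T}

lemma measurableSet_box {S T : Set ℝ} (hS : MeasurableSet S) (hT : MeasurableSet T) :
    MeasurableSet (box S T) :=
  (measurable_pi_apply 0 hS).inter (measurable_pi_apply 1 hT)

/-- A line at height `y` meets the box in length `volume S` if `y ∈ T` and in nothing otherwise.
Local finiteness, diffuseness, intensity and the null set in the final contradiction are all read
off from this product. -/
lemma lineField_box (ω : Config) {S T : Set ℝ} (hS : MeasurableSet S) (hT : MeasurableSet T) :
    lineField ω (box S T) = volume S * canonicalN ω T := by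
  rw [lineField_apply ω (measurableSet_box hS hT), ← lintegral_indicator_const hT]
  congr 1
  ext y
  rw [lineMeasure_apply y (measurableSet_box hS hT)]
  by_cases hy : y ∈ T <;> simp [box, hy]

/-- Sliding a line along itself preserves its length measure, so the horizontal component of `x`
disappears. This is why a flow that ignores that component still carries `ξ` equivariantly. -/
lemma shift_lineMeasure (x : Fin 2 → ℝ) (y : ℝ) :
    shift x (lineMeasure y) = lineMeasure (y - x 1) := by
  ext C hC
  have hm : Measurable fun z : Fin 2 → ℝ => z - x := by fun_prop
  rw [shift, Measure.map_apply hm hC, lineMeasure_apply y (hm hC), lineMeasure,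
    Measure.map_apply (measurable_lineMap _) hC, ← (measurePreserving_sub_right volume (x 0)).measure_preimage
      ((measurable_lineMap (y - x 1)) hC).nullMeasurableSet]
  congr 1
  ext t
  have : ![t, y] - x = ![t - x 0, y - x 1] := by
    ext i; fin_cases i <;> simp
  simp only [Set.mem_preimage, Set.mem_ofPred_eq, this]

lemma lineField_planeFlow (x : Fin 2 → ℝ) (ω : Config) :
    lineField (planeFlow x ω) = shift x (lineField ω) := by
  ext C hC
  have hm : Measurable fun z : Fin 2 → ℝ => z - x := by fun_prop
  have hy : Measurable fun y : ℝ => y - x 1 := by fun_prop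
  have hL : Measurable fun y => lineMeasure y C :=
    (Measure.measurable_coe hC).comp measurable_lineMeasure
  rw [lineField_apply _ hC, shift, Measure.map_apply hm hC, lineField_apply ω (hm hC)]
  have h1 : canonicalN (planeFlow x ω) = (canonicalN ω).map fun y => y - x 1 := rfl
  rw [h1, lintegral_map hL hy]
  congr 1
  ext y
  rw [← shift_lineMeasure, shift, Measure.map_apply hm hC]

lemma shift_volume {d : ℕ} (x : Fin d → ℝ) : shift x volume = volume :=
  (measurePreserving_sub_right volume x).map_eq

lemma isRandomMeasure_lineField (P : Measure Config) : IsRandomMeasure P lineField where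
  measurable := measurable_lineField
  finite_on_compact := by
    refine Filter.Eventually.of_forall fun ω K hK => ?_
    obtain ⟨r, hr⟩ := hK.isBounded.exists_norm_le
    obtain ⟨n, hn⟩ := exists_nat_ge r
    have hsub : K ⊆ box (window n) (window n) := fun z hz =>
      ⟨abs_le.1 ((norm_le_pi_norm z 0).trans ((hr z hz).trans hn)),
        abs_le.1 ((norm_le_pi_norm z 1).trans ((hr z hz).trans hn))⟩
    refine (measure_mono hsub).trans_lt ?_
    rw [lineField_box ω (measurableSet_window n) (measurableSet_window n)]
    exact ENNReal.mul_lt_top measure_Icc_lt_top (ω.measure_window_lt_top n)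

lemma isRandomMeasure_lebesgueField (P : Measure Config) : IsRandomMeasure P lebesgueField where
  measurable := measurable_const
  finite_on_compact := Filter.Eventually.of_forall fun _ _ hK =>
    hK.measure_lt_top (μ := volume)

lemma isDiffuse_lineField (P : Measure Config) : IsDiffuse P lineField := by
  refine Filter.Eventually.of_forall fun ω x => ?_
  have : ({x} : Set (Fin 2 → ℝ)) ⊆ box {x 0} Set.univ := by
    rintro _ rfl; exact ⟨rfl, trivial⟩
  refine measure_mono_null this ?_
  -- The total count may be infinite; the convention `0 * ∞ = 0` is used.
  rw [lineField_box ω (measurableSet_singleton _) MeasurableSet.univ]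
  simp

lemma isDiffuse_lebesgueField (P : Measure Config) : IsDiffuse P lebesgueField :=
  Filter.Eventually.of_forall fun _ x => measure_singleton (μ := volume) x

/-- The term `n = 0` vanishes, and cancelling `n + 1` against the factorial turns the rest into `r`
times the total mass. -/
lemma lintegral_natCast_poissonMeasure (r : NNReal) :
    ∫⁻ n, (n : ℝ≥0∞) ∂poissonMeasure r = r := by
  have h1 : ∀ n : ℕ, ENNReal.ofReal (Real.exp (-r) * (r : ℝ) ^ (n + 1) / ((n + 1).factorial : ℝ)) *
      ((n + 1 : ℕ) : ℝ≥0∞) = r * poissonMeasure r {n} := by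
    intro n
    rw [poissonMeasure_singleton, ← ENNReal.ofReal_natCast, ← ENNReal.ofReal_mul (by positivity),
      ← ENNReal.ofReal_coe_nnreal, ← ENNReal.ofReal_mul (by positivity)]
    congr 1
    rw [Nat.factorial_succ]
    push_cast
    field_simp
    ring
  have h2 : ∑' n : ℕ, poissonMeasure r {n} = 1 := by
    have := lintegral_countable' (μ := poissonMeasure r) (fun _ : ℕ => (1 : ℝ≥0∞))
    simpa using this.symm
  rw [poissonMeasure, lintegral_sum_measure]
  simp only [lintegral_smul_measure, lintegral_dirac]
  rw [tsum_eq_zero_add' ENNReal.summable]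
  simp only [smul_eq_mul, h1, ENNReal.tsum_mul_left, h2]
  simp

lemma intensity_lineField {P : Measure Config} (hP : IsPoissonProcess P canonicalN volume) :
    intensity P lineField = 1 := by
  have hbox : Set.Icc (0 : Fin 2 → ℝ) 1 = box (Set.Icc 0 1) (Set.Icc 0 1) := by
    ext z
    simp only [box, Set.mem_Icc, Pi.le_def, Fin.forall_fin_two, Set.mem_ofPred_eq, Pi.zero_apply,
      Pi.one_apply]
    tauto
  have hI : MeasurableSet (Set.Icc (0 : ℝ) 1) := measurableSet_Icc
  have hp := hP.poisson _ hI measure_Icc_lt_top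
  rw [intensity, hbox]
  simp only [lineField_box _ hI hI, Real.volume_Icc, sub_zero, ENNReal.ofReal_one, one_mul]
  have := lintegral_map (μ := P) (f := id) measurable_id (hP.measurable_count hI)
  simp only [id] at this
  rw [← this, hp, lintegral_map measurable_id' .of_discrete, lintegral_natCast_poissonMeasure]
  simp

lemma intensity_lebesgueField {P : Measure Config} [IsProbabilityMeasure P] :
    intensity P lebesgueField = 1 := by
  simp [intensity, lebesgueField, Real.volume_Icc_pi]

lemma isStationaryRM_lineField (P : Measure Config) : IsStationaryRM P planeFlow lineField :=
  Filter.Eventually.of_forall fun ω x => lineField_planeFlow x ω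

lemma isStationaryRM_lebesgueField (P : Measure Config) :
    IsStationaryRM P planeFlow lebesgueField :=
  Filter.Eventually.of_forall fun _ x => (shift_volume x).symm

lemma measurable_fields : Measurable fun ω => (lineField ω, lebesgueField ω) :=
  measurable_lineField.prodMk measurable_const

lemma fields_planeFlow (x : Fin 2 → ℝ) (ω : Config) :
    (lineField (planeFlow x ω), lebesgueField (planeFlow x ω)) =
      (shift x (lineField ω), shift x (lebesgueField ω)) :=
  Prod.ext (lineField_planeFlow x ω) (shift_volume x).symm

lemma jointlyStationary_fields {P : Measure Config}
    (hP : IsPoissonProcess P canonicalN volume) :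
    JointlyStationary P lineField lebesgueField := by
  intro x
  have hθ := isStationaryProb_planeFlow hP x
  simp only [← fields_planeFlow]
  refine ⟨(measurable_fields.comp hθ.measurable).aemeasurable, measurable_fields.aemeasurable, ?_⟩
  conv_rhs => rw [← hθ.map_eq, Measure.map_map measurable_fields hθ.measurable]
  rfl

/-- By equivariance of the fields, an invariant set of pairs pulls back to a flow-invariant event,
to which ergodicity of `P` applies. -/
lemma jointlyErgodic_fields {P : Measure Config}
    (hP : IsPoissonProcess P canonicalN volume) :
    JointlyErgodic P lineField lebesgueField := by
  intro A hA hinv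
  refine isErgodicProb_planeFlow hP _ (measurable_fields hA) fun x => ?_
  have hflow := isMeasurableFlow_planeFlow
  have hmem : ∀ y ω, (lineField ω, lebesgueField ω) ∈ A →
      (lineField (planeFlow y ω), lebesgueField (planeFlow y ω)) ∈ A := by
    intro y ω h
    rw [fields_planeFlow, ← hinv y]
    exact ⟨_, h, rfl⟩
  ext ω
  constructor
  · rintro ⟨ω', h, rfl⟩
    exact hmem x ω' h
  · intro h
    exact ⟨planeFlow (-x) ω, hmem (-x) ω h, by rw [hflow.add, add_neg_cancel, hflow.zero]⟩

/-! ### Non-existence of a balancing allocation -/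

/-- A configuration is carried by a countable set. -/
lemma Config.exists_countable_carrier (ω : Config) :
    ∃ S : Set ℝ, S.Countable ∧ canonicalN ω Sᶜ = 0 := by
  set μ := canonicalN ω
  have : IsLocallyFiniteMeasure μ := ⟨fun x => ⟨Set.Icc (x - 1) (x + 1),
    Icc_mem_nhds (by linarith) (by linarith), ω.2.1 _ isCompact_Icc⟩⟩
  set S := {x : ℝ | μ {x} ≠ 0}
  have hS : S.Countable := by
    have := Measure.countable_meas_pos_of_disjoint_iUnion (μ := μ) (As := fun x : ℝ => {x})
      (fun x => measurableSet_singleton x) (fun x y h => by simpa using h)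
    simpa [pos_iff_ne_zero] using this
  refine ⟨S, hS, measure_null_of_locally_null _ fun x hx => ?_⟩
  have hx0 : μ {x} = 0 := by simpa [S] using hx
  have hlim : Filter.Tendsto (fun δ => μ (Metric.closedBall x δ)) (nhdsWithin 0 (Set.Ioi 0))
      (nhds (μ {x})) := by
    refine ((tendsto_measure_cthickening_of_isCompact isCompact_singleton).mono_left
      nhdsWithin_le_nhds).congr' ?_
    filter_upwards [self_mem_nhdsWithin] with δ hδ
    rw [Metric.cthickening_singleton x (le_of_lt hδ)]
  rw [hx0] at hlim
  obtain ⟨δ, hδ1, hδ⟩ := ((hlim.eventually (gt_mem_nhds zero_lt_one)).and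
    self_mem_nhdsWithin).exists
  refine ⟨Metric.closedBall x δ, mem_nhdsWithin_of_mem_nhds (Metric.closedBall_mem_nhds x hδ), ?_⟩
  -- Off the atoms, small balls have mass below `1`, hence mass `0` by integrality: the complement
  -- of `S` is locally null.
  obtain ⟨n, hn⟩ := ω.exists_nat_eq (B := Metric.closedBall x δ)
    Metric.isClosed_closedBall.measurableSet (hδ1.trans ENNReal.one_lt_top).ne
  change μ _ = _ at hn
  rw [hn] at hδ1 ⊢
  have : n < 1 := by exact_mod_cast hδ1
  simp [Nat.lt_one_iff.1 this]

/-- An allocation commutes with the horizontal translations, which act trivially on the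
configurations, so that it maps horizontal lines into horizontal lines. -/
lemma not_exists_balancing_allocation {P : Measure Config} [IsProbabilityMeasure P] :
    ¬ ∃ τ : Config → (Fin 2 → ℝ) → OnePoint (Fin 2 → ℝ),
      IsAllocation P planeFlow τ ∧ Balances P τ lineField lebesgueField := by
  rintro ⟨τ, hτ, hbal⟩
  -- A single good configuration suffices, since equivariance holds there for all `x` and `y` at
  -- once.
  obtain ⟨ω, hω, himg⟩ := (hτ.equivariant.and hbal.image).exists
  obtain ⟨S, hS, hSω⟩ := ω.exists_countable_carrier
  have hline : ∀ s z : Fin 2 → ℝ, τ ω s = z → τ ω ![0, s 1] = ((z - ![s 0, 0] : Fin 2 → ℝ)) := by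
    intro s z hz
    have h := hω s ![s 0, 0]
    have h1 : planeFlow ![s 0, 0] ω = ω := Config.translate_zero ω
    have h2 : s - ![s 0, 0] = ![0, s 1] := by ext i; fin_cases i <;> simp
    rw [h1, h2, hz] at h
    exact h
  -- The value `0` at `∞` is harmless: it adds at most one height to the countable set `H`.
  let height : OnePoint (Fin 2 → ℝ) → ℝ := fun p => p.elim 0 fun z => z 1
  set H := (fun u => height (τ ω ![0, u])) '' S
  have hH : H.Countable := hS.image _
  -- The plane without the lines reachable from the carrier `S`. Only points at heights outside `S`
  -- can be sent into `C`, so `ξ` gives its preimage mass `0`, whereas the complement of `C` is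
  -- Lebesgue null.
  set C : Set (Fin 2 → ℝ) := box Set.univ Hᶜ
  have hC : MeasurableSet C := measurableSet_box MeasurableSet.univ hH.measurableSet.compl
  have h0 : lineField ω {s | ∃ z ∈ C, τ ω s = (z : OnePoint (Fin 2 → ℝ))} = 0 := by
    refine measure_mono_null (t := box Set.univ Sᶜ) ?_ ?_
    · rintro s ⟨z, hz, hs⟩
      refine ⟨trivial, fun hsS => hz.2 ⟨s 1, hsS, ?_⟩⟩
      simp only [hline s z hs]
      change (z - ![s 0, 0]) 1 = z 1
      simp only [Pi.sub_apply, Matrix.cons_val_one, Matrix.cons_val_fin_one, sub_zero]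
    · rw [lineField_box ω MeasurableSet.univ hS.measurableSet.compl, hSω, mul_zero]
  rw [himg C hC] at h0
  have h1 : (volume : Measure (Fin 2 → ℝ)) Cᶜ = 0 := by
    have hsub : Cᶜ ⊆ ⋃ v ∈ H, {z : Fin 2 → ℝ | z 1 = v} := by
      intro z hz
      have : z 1 ∈ H := by
        by_contra hne
        exact hz ⟨trivial, hne⟩
      exact Set.mem_biUnion this rfl
    refine measure_mono_null hsub ((measure_biUnion_null_iff hH).2 fun v _ => ?_)
    exact Measure.pi_hyperplane (fun _ : Fin 2 => (volume : Measure ℝ)) 1 v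
  have h2 : (volume : Measure (Fin 2 → ℝ)) Set.univ = 0 := by
    rw [← Set.union_compl_self C]
    exact measure_union_null h0 h1
  exact NeZero.ne (volume : Measure (Fin 2 → ℝ)) (Measure.measure_univ_eq_zero.1 h2)

/-! ### Poisson processes with a probability measure as intensity -/

/-- Characteristic functions determine laws on `ℝ`, and passing from `ℝ≥0∞` to `ℝ` and back loses
only the value `∞`, which has probability `0`. -/
lemma map_eq_poissonMeasure_of_charFun {Ω : Type*} [MeasurableSpace Ω] {P : Measure Ω}
    [IsProbabilityMeasure P] {Y : Ω → ℝ≥0∞} (hY : Measurable Y) (hfin : ∀ᵐ ω ∂P, Y ω ≠ ∞)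
    (r : NNReal)
    (h : ∀ t : ℝ, ∫ ω, Complex.exp ((Y ω).toReal * t * Complex.I) ∂P =
      Complex.exp (r * (Complex.exp (t * Complex.I) - 1))) :
    P.map Y = (poissonMeasure r).map (fun n : ℕ => (n : ℝ≥0∞)) := by
  have hYr : Measurable fun ω => (Y ω).toReal := hY.ennreal_toReal
  have hreal : P.map (fun ω => (Y ω).toReal) = (poissonMeasure r).map (fun n : ℕ => (n : ℝ)) := by
    have := Measure.isProbabilityMeasure_map (μ := P) hYr.aemeasurable
    refine Measure.ext_of_charFun ?_
    ext t
    rw [charFun_map_cast_poissonMeasure, ← h t, charFun_apply,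
      integral_map hYr.aemeasurable (by fun_prop)]
    simp [mul_comm]
  have h1 : P.map Y = (P.map fun ω => (Y ω).toReal).map ENNReal.ofReal := by
    rw [Measure.map_map ENNReal.measurable_ofReal hYr]
    refine Measure.map_congr ?_
    filter_upwards [hfin] with ω hω
    simp [ENNReal.ofReal_toReal hω]
  rw [h1, hreal, Measure.map_map ENNReal.measurable_ofReal .of_discrete]
  congr 1
  ext n
  simp

section Sample

variable {X : Type*} [MeasurableSpace X]

/-- The empirical measure of the first `e.1` terms of the sequence `e.2`. -/
def sample (e : ℕ × (ℕ → X)) : Measure X := ∑ i ∈ Finset.range e.1, Measure.dirac (e.2 i)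

/-- A Poisson number with mean `1` together with a sequence of independent points with law `ν`. -/
def sampleLaw (ν : Measure X) [IsProbabilityMeasure ν] : Measure (ℕ × (ℕ → X)) :=
  (poissonMeasure 1).prod (Measure.infinitePi fun _ => ν)

instance (ν : Measure X) [IsProbabilityMeasure ν] : IsProbabilityMeasure (sampleLaw ν) := by
  unfold sampleLaw; infer_instance

open Classical in
lemma sample_apply (e : ℕ × (ℕ → X)) {B : Set X} (hB : MeasurableSet B) :
    sample e B = (((Finset.range e.1).filter fun i => e.2 i ∈ B).card : ℝ≥0∞) := by
  simp [sample, Measure.dirac_apply' _ hB, Set.indicator_apply, Finset.sum_boole]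

lemma sample_ne_top (e : ℕ × (ℕ → X)) {B : Set X} (hB : MeasurableSet B) : sample e B ≠ ∞ := by
  classical
  simp [sample_apply e hB]

lemma sample_toReal (e : ℕ × (ℕ → X)) {B : Set X} (hB : MeasurableSet B) :
    (sample e B).toReal = ∑ i ∈ Finset.range e.1, B.indicator (fun _ => (1 : ℝ)) (e.2 i) := by
  classical
  simp [sample_apply e hB, Set.indicator_apply, Finset.sum_boole]

lemma measurable_sample : Measurable (sample : ℕ × (ℕ → X) → Measure X) := by
  refine Measure.measurable_of_measurable_coe _ fun B hB =>
    measurable_from_prod_countable_right fun n => ?_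
  simp only [sample, Measure.finsetSum_apply, Measure.dirac_apply' _ hB]
  exact Finset.measurable_sum _ fun i _ =>
    (measurable_one.indicator hB).comp (measurable_pi_apply i)

/-- Given `n` points, independence yields `z ^ n` with `z` the one-point integral; averaging over a
Poisson number with mean `1` gives `exp (z - 1)`. -/
lemma integral_cexp_sample (ν : Measure X) [IsProbabilityMeasure ν] {h : X → ℝ}
    (hh : Measurable h) :
    ∫ e, Complex.exp ((∑ i ∈ Finset.range e.1, h (e.2 i) : ℝ) * Complex.I) ∂sampleLaw ν =
      Complex.exp (∫ x, Complex.exp (h x * Complex.I) ∂ν - 1) := by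
  have hm : Measurable fun e : ℕ × (ℕ → X) =>
      Complex.exp ((∑ i ∈ Finset.range e.1, h (e.2 i) : ℝ) * Complex.I) := by
    refine measurable_from_prod_countable_right fun n => ?_
    have : Measurable fun u : ℕ → X => ∑ i ∈ Finset.range n, h (u i) :=
      Finset.measurable_sum _ fun i _ => hh.comp (measurable_pi_apply i)
    change Measurable fun u : ℕ → X => Complex.exp ((∑ i ∈ Finset.range n, h (u i) : ℝ) * Complex.I)
    fun_prop
  have hint : Integrable (fun e : ℕ × (ℕ → X) =>
      Complex.exp ((∑ i ∈ Finset.range e.1, h (e.2 i) : ℝ) * Complex.I)) (sampleLaw ν) :=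
    Integrable.of_bound hm.aestronglyMeasurable 1
      (Filter.Eventually.of_forall fun e => (Complex.norm_exp_ofReal_mul_I _).le)
  set z := ∫ x, Complex.exp (h x * Complex.I) ∂ν with hz
  have hinner : ∀ n : ℕ, ∫ u : ℕ → X, Complex.exp ((∑ i ∈ Finset.range n, h (u i) : ℝ) * Complex.I)
      ∂(Measure.infinitePi fun _ => ν) = z ^ n := by
    intro n
    have e1 : ∀ u : ℕ → X, Complex.exp ((∑ i ∈ Finset.range n, h (u i) : ℝ) * Complex.I) =
        ∏ i : Finset.range n, Complex.exp (h ((Finset.range n).restrict u i) * Complex.I) := by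
      intro u
      rw [Complex.ofReal_sum, Finset.sum_mul, Complex.exp_sum,
        ← Finset.prod_coe_sort]
      rfl
    simp_rw [e1]
    rw [integral_restrict_infinitePi (fun _ => ν)
      (f := fun y : Finset.range n → X => ∏ i, Complex.exp (h (y i) * Complex.I))
      (Finset.measurable_prod _ fun i _ => by fun_prop).aestronglyMeasurable, integral_fintype_prod_eq_pow (fun x => Complex.exp (h x * Complex.I))]
    simp [hz]
  rw [sampleLaw, integral_prod _ hint]
  simp only [hinner]
  rw [integral_poissonMeasure]
  have hexp := NormedSpace.expSeries_div_hasSum_exp (𝔸 := ℂ) z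
  rw [← Complex.exp_eq_exp_ℂ] at hexp
  have h2 := hexp.mul_left (Complex.exp (-1))
  rw [← Complex.exp_add, neg_add_eq_sub] at h2
  rw [← h2.tsum_eq]
  congr 1
  ext n
  rw [Complex.real_smul]
  push_cast
  simp
  ring

/-- By disjointness at most one indicator is nonzero at each point, so the exponential of the sum is
affine in the indicators. -/
lemma integral_cexp_sum_indicator (ν : Measure X) [IsProbabilityMeasure ν] {ι : Type*} [Fintype ι]
    {B : ι → Set X} (hB : ∀ i, MeasurableSet (B i))
    (hd : Pairwise (fun i j => Disjoint (B i) (B j))) (t : ι → ℝ) :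
    ∫ x, Complex.exp ((∑ j, (B j).indicator (fun _ => t j) x : ℝ) * Complex.I) ∂ν =
      1 + ∑ j, ν.real (B j) * (Complex.exp (t j * Complex.I) - 1) := by
  have hpt : ∀ x, Complex.exp ((∑ j, (B j).indicator (fun _ => t j) x : ℝ) * Complex.I) =
      1 + ∑ j, (B j).indicator (fun _ => Complex.exp (t j * Complex.I) - 1) x := by
    intro x
    by_cases hx : ∃ j, x ∈ B j
    · obtain ⟨j, hj⟩ := hx
      have hne : ∀ k, k ≠ j → x ∉ B k := fun k hk hxk =>
        Set.disjoint_left.1 (hd hk) hxk hj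
      rw [Finset.sum_eq_single j (fun k _ hk => Set.indicator_of_notMem (hne k hk) _) (by simp),
        Finset.sum_eq_single j (fun k _ hk => Set.indicator_of_notMem (hne k hk) _) (by simp)]
      simp [hj]
    · push Not at hx
      simp [hx]
  have hint : ∀ j, Integrable
      (fun x => (B j).indicator (fun _ => Complex.exp (t j * Complex.I) - 1) x) ν :=
    fun j => (integrable_const _).indicator (hB j)
  simp_rw [hpt]
  rw [integral_add (integrable_const _) (integrable_finsetSum _ fun j _ => hint j),
    integral_finsetSum _ fun j _ => hint j]
  congr 1
  · simp
  · refine Finset.sum_congr rfl fun j _ => ?_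
    rw [integral_indicator_const _ (hB j), Complex.real_smul]

/-- Taking `h = ∑ j, t j • 1_{B j}` in `integral_cexp_sample`, the joint characteristic function
factors over `j`. The factors give the Poisson laws, the factorization gives independence. -/
lemma integral_cexp_counts (ν : Measure X) [IsProbabilityMeasure ν] {ι : Type*} [Fintype ι]
    {B : ι → Set X} (hB : ∀ i, MeasurableSet (B i))
    (hd : Pairwise (fun i j => Disjoint (B i) (B j))) (t : ι → ℝ) :
    ∫ e, Complex.exp ((∑ j, (sample e (B j)).toReal * t j : ℝ) * Complex.I) ∂sampleLaw ν =
      ∏ j, Complex.exp (ν.real (B j) * (Complex.exp (t j * Complex.I) - 1)) := by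
  have e1 : ∀ e : ℕ × (ℕ → X), ∑ j, (sample e (B j)).toReal * t j =
      ∑ i ∈ Finset.range e.1, ∑ j, (B j).indicator (fun _ => t j) (e.2 i) := by
    intro e
    rw [Finset.sum_comm]
    refine Finset.sum_congr rfl fun j _ => ?_
    rw [sample_toReal e (hB j), Finset.sum_mul]
    refine Finset.sum_congr rfl fun i _ => ?_
    by_cases h : e.2 i ∈ B j <;> simp [h]
  simp_rw [e1]
  rw [integral_cexp_sample ν (h := fun x => ∑ j, (B j).indicator (fun _ => t j) x)
    (Finset.measurable_sum _ fun j _ => measurable_const.indicator (hB j)),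
    integral_cexp_sum_indicator ν hB hd t, add_sub_cancel_left, Complex.exp_sum]

lemma integral_cexp_count (ν : Measure X) [IsProbabilityMeasure ν] {B : Set X}
    (hB : MeasurableSet B) (t : ℝ) :
    ∫ e, Complex.exp ((sample e B).toReal * t * Complex.I) ∂sampleLaw ν =
      Complex.exp (ν.real B * (Complex.exp (t * Complex.I) - 1)) := by
  simpa using integral_cexp_counts ν (ι := Unit) (B := fun _ => B) (fun _ => hB)
    (fun i j h => (h rfl).elim) (fun _ => t)

/-- A Poisson number of independent points with law `ν` forms a Poisson process with intensity
measure `ν`. -/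
lemma isPoissonProcess_sample (ν : Measure X) [IsProbabilityMeasure ν] :
    IsPoissonProcess (sampleLaw ν) sample ν where
  isProbabilityMeasure := inferInstance
  measurable := measurable_sample
  poisson B hB _ := by
    refine map_eq_poissonMeasure_of_charFun ((Measure.measurable_coe hB).comp measurable_sample)
      (Filter.Eventually.of_forall fun e => sample_ne_top e hB) _ fun t => ?_
    exact integral_cexp_count ν hB t
  indep m B hB hd := by
    have hm : ∀ i, Measurable fun e : ℕ × (ℕ → X) => (sample e (B i)).toReal := fun i =>
      ((Measure.measurable_coe (hB i)).comp measurable_sample).ennreal_toReal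
    have hreal : iIndepFun (fun i (e : ℕ × (ℕ → X)) => (sample e (B i)).toReal)
        (sampleLaw ν) := by
      rw [iIndepFun_iff_charFun_pi fun i => (hm i).aemeasurable]
      intro t
      have hvec : Measurable fun e : ℕ × (ℕ → X) =>
          WithLp.toLp 2 fun i => (sample e (B i)).toReal :=
        (WithLp.measurable_toLp 2 _).comp (measurable_pi_lambda _ hm)
      rw [charFun_apply, integral_map hvec.aemeasurable (by fun_prop)]
      have e1 : ∀ i, charFun ((sampleLaw ν).map fun e => (sample e (B i)).toReal) (t i) =
          Complex.exp (ν.real (B i) * (Complex.exp (t i * Complex.I) - 1)) := by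
        intro i
        rw [charFun_apply, integral_map (hm i).aemeasurable (by fun_prop),
          ← integral_cexp_count ν (hB i)]
        simp [mul_comm]
      simp_rw [e1]
      rw [← integral_cexp_counts ν hB hd]
      simp [PiLp.inner_apply, mul_comm]
    have := hreal.comp (fun _ => ENNReal.ofReal) fun _ => ENNReal.measurable_ofReal
    convert this using 3 with i e
    exact (ENNReal.ofReal_toReal (sample_ne_top e (hB i))).symm

end Sample

/-! ### Superposition of independent Poisson processes -/

section Superposition

variable {X : Type*} [MeasurableSpace X] {Ω : ℕ → Type*} [∀ k, MeasurableSpace (Ω k)]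
  {P : ∀ k, Measure (Ω k)} {N : ∀ k, Ω k → Measure X} {Λ : ℕ → Measure X}

/-- The sum is a.s. finite because its mean is. Partial sums have the Poisson characteristic
function with the partial parameter, and dominated convergence passes to the limit. -/
lemma map_tsum_eq_poissonMeasure {Ω' : Type*} [MeasurableSpace Ω'] {Q : Measure Ω'}
    [IsProbabilityMeasure Q] {Y : ℕ → Ω' → ℝ≥0∞} (hY : ∀ k, Measurable (Y k))
    (hind : iIndepFun Y Q) {r : ℕ → NNReal} (hr : ∑' k, (r k : ℝ≥0∞) ≠ ∞)
    (hlaw : ∀ k, Q.map (Y k) = (poissonMeasure (r k)).map (fun n : ℕ => (n : ℝ≥0∞))) :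
    Q.map (fun ω => ∑' k, Y k ω) =
      (poissonMeasure (∑' k, (r k : ℝ≥0∞)).toNNReal).map (fun n : ℕ => (n : ℝ≥0∞)) := by
  have hYm : Measurable fun ω => ∑' k, Y k ω := Measurable.tsum hY
  have hmean : ∀ k, ∫⁻ ω, Y k ω ∂Q = r k := by
    intro k
    have := lintegral_map (μ := Q) (f := id) measurable_id (hY k)
    simp only [id] at this
    rw [← this, hlaw k, lintegral_map measurable_id' .of_discrete,
      lintegral_natCast_poissonMeasure]
  have hfin : ∀ᵐ ω ∂Q, ∑' k, Y k ω ≠ ∞ := by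
    refine (ae_lt_top hYm ?_).mono fun ω h => h.ne
    rw [lintegral_tsum fun k => (hY k).aemeasurable]
    simpa only [hmean] using hr
  refine map_eq_poissonMeasure_of_charFun hYm hfin _ fun t => ?_
  have hYr : ∀ k, Measurable fun ω => (Y k ω).toReal := fun k => (hY k).ennreal_toReal
  have hindr : iIndepFun (fun k ω => (Y k ω).toReal) Q :=
    hind.comp (fun _ => ENNReal.toReal) fun _ => ENNReal.measurable_toReal
  have hchar : ∀ k, charFun (Q.map fun ω => (Y k ω).toReal) t =
      Complex.exp (r k * (Complex.exp (t * Complex.I) - 1)) := by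
    intro k
    have e : Q.map (fun ω => (Y k ω).toReal) = (Q.map (Y k)).map ENNReal.toReal :=
      (Measure.map_map ENNReal.measurable_toReal (hY k)).symm
    rw [e, hlaw k, Measure.map_map ENNReal.measurable_toReal .of_discrete,
      ← charFun_map_cast_poissonMeasure]
    rfl
  have hpartial : ∀ n, ∫ ω, Complex.exp
      ((∑ k ∈ Finset.range n, (Y k ω).toReal : ℝ) * t * Complex.I) ∂Q =
      Complex.exp ((∑ k ∈ Finset.range n, (r k : ℝ) : ℝ) *
        (Complex.exp (t * Complex.I) - 1)) := by
    intro n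
    have h1 := congrFun (iIndepFun.charFun_map_fun_finsetSum_eq_prod (s := Finset.range n)
      (fun k _ => (hYr k).aemeasurable) (hindr.restrict _)) t
    rw [charFun_apply, integral_map
      (Finset.measurable_sum _ fun k _ => hYr k).aemeasurable (by fun_prop),
      Finset.prod_apply] at h1
    simp_rw [hchar] at h1
    rw [← Complex.exp_sum, ← Finset.sum_mul] at h1
    push_cast
    rw [← h1]
    simp [mul_comm]
  have hlim1 : Filter.Tendsto (fun n => ∫ ω, Complex.exp
      ((∑ k ∈ Finset.range n, (Y k ω).toReal : ℝ) * t * Complex.I) ∂Q) Filter.atTop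
      (nhds (∫ ω, Complex.exp (((∑' k, Y k ω).toReal : ℝ) * t * Complex.I) ∂Q)) := by
    refine tendsto_integral_of_dominated_convergence (fun _ => 1) (fun n => ?_)
      (integrable_const _) (fun n => ?_) ?_
    · have := Finset.measurable_sum (Finset.range n) fun k _ => hYr k
      exact Measurable.aestronglyMeasurable (by fun_prop)
    · refine Filter.Eventually.of_forall fun ω => ?_
      rw [← Complex.ofReal_mul, Complex.norm_exp_ofReal_mul_I]
    · filter_upwards [hfin] with ω hω
      have h1 := (ENNReal.hasSum_toReal hω).tendsto_sum_nat
      rw [← ENNReal.tsum_toReal_eq fun k => ENNReal.ne_top_of_tsum_ne_top hω k] at h1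
      exact ((Complex.continuous_exp.comp (by fun_prop :
        Continuous fun x : ℝ => (x : ℂ) * t * Complex.I)).tendsto _).comp h1
  have hlim2 : Filter.Tendsto (fun n => Complex.exp ((∑ k ∈ Finset.range n, (r k : ℝ) : ℝ) *
        (Complex.exp (t * Complex.I) - 1))) Filter.atTop
      (nhds (Complex.exp (((∑' k, (r k : ℝ≥0∞)).toNNReal : ℝ) *
        (Complex.exp (t * Complex.I) - 1)))) := by
    have h1 := (ENNReal.hasSum_toReal hr).tendsto_sum_nat
    rw [← ENNReal.tsum_toReal_eq fun k => ENNReal.coe_ne_top] at h1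
    exact ((Complex.continuous_exp.comp (by fun_prop :
      Continuous fun x : ℝ => (x : ℂ) * (Complex.exp (t * Complex.I) - 1))).tendsto _).comp h1
  simp_rw [hpartial] at hlim1
  exact tendsto_nhds_unique hlim1 hlim2

/-- The superposition of countably many independent Poisson processes is a Poisson process. -/
lemma isPoissonProcess_superposition [∀ k, IsProbabilityMeasure (P k)]
    (h : ∀ k, IsPoissonProcess (P k) (N k) (Λ k)) :
    IsPoissonProcess (Measure.infinitePi P) (fun ω => Measure.sum fun k => N k (ω k))
      (Measure.sum Λ) := by
  have heval : ∀ k, Measurable fun ω : ∀ k, Ω k => ω k := fun k => measurable_pi_apply k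
  have hcount : ∀ k {B : Set X}, MeasurableSet B →
      Measurable fun ω : ∀ k, Ω k => N k (ω k) B := fun k B hB =>
    ((h k).measurable_count hB).comp (heval k)
  have hind : ∀ B : Set X, MeasurableSet B →
      iIndepFun (fun k (ω : ∀ k, Ω k) => N k (ω k) B) (Measure.infinitePi P) := fun B hB =>
    iIndepFun_infinitePi (X := fun k ω => N k ω B) fun k => (h k).measurable_count hB
  refine ⟨inferInstance, ?_, fun B hB hΛ => ?_, fun m B hB hd => ?_⟩
  · refine Measure.measurable_of_measurable_coe _ fun B hB => ?_
    simp only [Measure.sum_apply _ hB]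
    exact Measurable.tsum fun k => hcount k hB
  · simp only [Measure.sum_apply _ hB] at hΛ ⊢
    have hk : ∀ k, Λ k B ≠ ∞ := fun k => ENNReal.ne_top_of_tsum_ne_top hΛ.ne k
    have e : ∀ k, (((Λ k B).toNNReal : NNReal) : ℝ≥0∞) = Λ k B :=
      fun k => ENNReal.coe_toNNReal (hk k)
    have := map_tsum_eq_poissonMeasure (fun k => hcount k hB) (hind B hB)
      (r := fun k => (Λ k B).toNNReal) (by simpa only [e] using hΛ.ne) fun k => by
        rw [← (h k).poisson B hB (hk k).lt_top, ← Measure.infinitePi_map_eval P k,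
          Measure.map_map ((h k).measurable_count hB) (heval k)]
        rfl
    simpa only [e] using this
  · let Y : Fin m → ℕ → (∀ k, Ω k) → ℝ≥0∞ := fun j k ω => N k (ω k) (B j)
    have hYm : ∀ j k, Measurable (Y j k) := fun j k => hcount k (hB j)
    -- The whole array of counts is independent: across `k` by the product measure, across `j` by
    -- each Poisson process. Regrouping it by `j` makes the sequences `(Y j k)_k` independent, and
    -- so are their sums over `k`.
    have huncurry : iIndepFun (fun (p : ℕ × Fin m) ω => Y p.2 p.1 ω) (Measure.infinitePi P) := by
      refine iIndepFun_uncurry' (X := fun k j => Y j k) (fun k j => hYm j k) ?_ fun k => ?_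
      · exact iIndepFun_infinitePi (X := fun k ω j => N k ω (B j))
          fun k => measurable_pi_lambda _ fun j => (h k).measurable_count (hB j)
      · refine (iIndepFun_map_iff (f := fun j ω => N k ω (B j))
          (fun j => (h k).measurable_count (hB j)) (heval k)).1 ?_
        rw [Measure.infinitePi_map_eval P k]
        exact (h k).indep m B hB hd
    have hprod : ∀ j k, IsProbabilityMeasure ((Measure.infinitePi P).map (Y j k)) :=
      fun j k => Measure.isProbabilityMeasure_map (hYm j k).aemeasurable
    have hlaw := (huncurry.precomp (g := Prod.swap) Prod.swap_injective).map_fun_eq_infinitePi_map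
      fun p : Fin m × ℕ => hYm p.1 p.2
    have hproc : iIndepFun (fun j ω k => Y j k ω) (Measure.infinitePi P) := by
      rw [iIndepFun_iff_map_fun_eq_infinitePi_map fun j => measurable_pi_lambda _ (hYm j)]
      have e : ∀ j, (Measure.infinitePi P).map (fun ω k => Y j k ω) =
          Measure.infinitePi fun k => (Measure.infinitePi P).map (Y j k) := fun j =>
        (hind (B j) (hB j)).map_fun_eq_infinitePi_map (hYm j)
      rw [show (fun j => (Measure.infinitePi P).map fun ω k => Y j k ω) = _ from funext e,
        ← Measure.infinitePi_map_curry]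
      have hlaw' : (Measure.infinitePi P).map (fun ω (p : Fin m × ℕ) => Y p.1 p.2 ω) =
          Measure.infinitePi fun p : Fin m × ℕ => (Measure.infinitePi P).map (Y p.1 p.2) := hlaw
      have hall : Measurable fun ω (p : Fin m × ℕ) => Y p.1 p.2 ω :=
        measurable_pi_lambda _ fun p => hYm p.1 p.2
      rw [← hlaw', Measure.map_map (MeasurableEquiv.measurable _) hall]
      rfl
    simp only [fun j (ω : ∀ k, Ω k) => Measure.sum_apply (fun k => N k (ω k)) (hB j)]
    exact hproc.comp (fun _ c => ∑' k, c k)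
      fun _ => Measurable.tsum fun k => measurable_pi_apply k

end Superposition

/-! ### Existence of the canonical process on the line -/

/-- An enumeration of the integers. -/
def cellIndex : ℕ ≃ ℤ := Equiv.intEquivNat.symm

/-- The parametrization of the unit interval starting at the `k`-th integer. -/
def cellMap (k : ℕ) (u : unitInterval) : ℝ := u + (cellIndex k : ℝ)

lemma measurable_cellMap (k : ℕ) : Measurable (cellMap k) :=
  measurable_subtype_coe.add_const _

/-- The closed cell is replaced by a half-open one, which differs by a null endpoint, so that the
cells tile the line disjointly. -/
lemma map_cellMap (k : ℕ) : (volume : Measure unitInterval).map (cellMap k) =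
    volume.restrict (Set.Ico (cellIndex k : ℝ) (cellIndex k + 1)) := by
  have h1 : (volume : Measure unitInterval).map Subtype.val =
      volume.restrict (Set.Icc (0 : ℝ) 1) := by
    rw [unitInterval.volume_def]
    exact (measurePreserving_subtype_coe measurableSet_Icc).map_eq
  have hadd : Measurable fun x : ℝ => x + (cellIndex k : ℝ) := by fun_prop
  have h2 : (volume : Measure unitInterval).map (cellMap k) =
      ((volume : Measure unitInterval).map Subtype.val).map fun x => x + (cellIndex k : ℝ) := by
    rw [Measure.map_map hadd measurable_subtype_coe]
    rfl
  have h3 : Set.Icc (0 : ℝ) 1 = (fun x : ℝ => x + (cellIndex k : ℝ)) ⁻¹'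
      Set.Icc (cellIndex k : ℝ) (cellIndex k + 1) := by
    ext x
    simp [add_comm]
  rw [h2, h1, h3, ← Measure.restrict_map hadd measurableSet_Icc,
    (measurePreserving_add_right volume _).map_eq]
  exact (restrict_Ico_eq_restrict_Icc).symm

lemma sum_map_cellMap :
    Measure.sum (fun k => (volume : Measure unitInterval).map (cellMap k)) = volume := by
  simp_rw [map_cellMap]
  have hd : Pairwise (Function.onFun Disjoint fun k : ℕ =>
      Set.Ico (cellIndex k : ℝ) (cellIndex k + 1)) := fun i j hij =>
    Set.pairwise_disjoint_Ico_intCast ℝ (cellIndex.injective.ne hij)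
  rw [← Measure.restrict_iUnion hd fun k => measurableSet_Ico,
    cellIndex.surjective.iUnion_comp fun n : ℤ => Set.Ico (n : ℝ) (n + 1), iUnion_Ico_intCast,
    Measure.restrict_univ]

/-- In a finite sum only finitely many terms reach `1`, and the other terms, being integers, vanish.
-/
lemma exists_enat_eq_tsum {c : ℕ → ℝ≥0∞} (hc : ∀ k, ∃ n : ℕ, c k = n) :
    ∃ n : ℕ∞, ∑' k, c k = (n : ℝ≥0∞) := by
  choose n hn using hc
  by_cases htop : ∑' k, c k = ∞
  · exact ⟨⊤, by simpa using htop⟩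
  · have hfin := ENNReal.finite_const_le_of_tsum_ne_top htop one_ne_zero
    refine ⟨((∑ k ∈ hfin.toFinset, n k : ℕ) : ℕ∞), ?_⟩
    rw [tsum_eq_sum (s := hfin.toFinset)]
    · rw [ENat.toENNReal_coe, Nat.cast_sum]
      exact Finset.sum_congr rfl fun k _ => hn k
    · intro k hk
      have hlt : c k < 1 := by simpa using hk
      rw [hn k] at hlt ⊢
      have : n k < 1 := by exact_mod_cast hlt
      simp [Nat.lt_one_iff.1 this]

/-- The points obtained by placing the `k`-th sample into the `k`-th unit interval. -/
def cellPoints (ω : ℕ → ℕ × (ℕ → unitInterval)) : Measure ℝ :=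
  Measure.sum fun k => (sample (ω k)).map (cellMap k)

lemma cellPoints_apply (ω : ℕ → ℕ × (ℕ → unitInterval)) {B : Set ℝ} (hB : MeasurableSet B) :
    cellPoints ω B = ∑' k, sample (ω k) (cellMap k ⁻¹' B) := by
  rw [cellPoints, Measure.sum_apply _ hB]
  simp only [Measure.map_apply (measurable_cellMap _) hB]

/-- Local finiteness is needed for every `ω`, not just almost surely, since `cellConfig` must take
values in the subtype `Config`. -/
lemma cellPoints_lt_top (ω : ℕ → ℕ × (ℕ → unitInterval)) {K : Set ℝ} (hK : IsCompact K) :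
    cellPoints ω K < ∞ := by
  obtain ⟨r, hr⟩ := hK.isBounded.exists_norm_le
  rw [cellPoints_apply ω hK.measurableSet]
  -- A point `u + c` with `u ∈ [0, 1]` and `|u + c| ≤ r` forces `-r - 1 ≤ c ≤ r`, so only finitely
  -- many cells meet `K`.
  have hfin : (cellIndex ⁻¹' Set.Icc (-⌈r⌉ - 1) ⌈r⌉).Finite :=
    (Set.finite_Icc _ _).preimage cellIndex.injective.injOn
  rw [tsum_eq_sum (s := hfin.toFinset)]
  · exact ENNReal.sum_lt_top.2 fun k _ =>
      (sample_ne_top _ (measurable_cellMap k hK.measurableSet)).lt_top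
  · intro k hk
    have hempty : cellMap k ⁻¹' K = ∅ := by
      refine Set.eq_empty_of_forall_notMem fun u hu => hk ?_
      have h1 := abs_le.1 (hr _ hu)
      have h2 := Int.le_ceil r
      simp only [cellMap] at h1
      have h3 := u.2.1
      have h4 := u.2.2
      simp only [Set.Finite.mem_toFinset, Set.mem_preimage, Set.mem_Icc]
      constructor
      · have : ((-⌈r⌉ - 1 : ℤ) : ℝ) ≤ cellIndex k := by push_cast; linarith
        exact_mod_cast this
      · have : ((cellIndex k : ℤ) : ℝ) ≤ ⌈r⌉ := by linarith
        exact_mod_cast this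
    rw [hempty, measure_empty]

/-- The configuration with points `cellPoints ω`. -/
def cellConfig (ω : ℕ → ℕ × (ℕ → unitInterval)) : Config :=
  ⟨cellPoints ω, fun _ hK => cellPoints_lt_top ω hK, fun B hB => by
    rw [cellPoints_apply ω hB]
    exact exists_enat_eq_tsum fun k => by
      classical
      exact ⟨_, sample_apply (ω k) (measurable_cellMap k hB)⟩⟩

lemma exists_isPoissonProcess_canonicalN :
    ∃ P : Measure Config, IsPoissonProcess P canonicalN volume := by
  have h := isPoissonProcess_superposition fun k =>
    (isPoissonProcess_sample (volume : Measure unitInterval)).map_space (measurable_cellMap k)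
  rw [sum_map_cellMap] at h
  have hm : Measurable cellConfig := Measurable.subtype_mk h.measurable
  exact ⟨_, IsPoissonProcess.map_prob hm measurable_canonicalN h⟩

end BalancingAllocation

end

open BalancingAllocation in
theorem mainTheorem3 :
    -- the canonical stationary Poisson process with intensity 1 exists
    (∃ P : Measure Config, IsPoissonProcess P canonicalN volume) ∧
    ∀ P : Measure Config, IsPoissonProcess P canonicalN volume →
      -- the standing framework: a stationary ergodic probability measure under a measurable flow
      (IsMeasurableFlow planeFlow ∧ IsStationaryProb P planeFlow ∧ IsErgodicProb P planeFlow) ∧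
      -- `ξ` and `η` are stationary random measures, jointly stationary and ergodic
      (IsRandomMeasure P lineField ∧ IsRandomMeasure P lebesgueField) ∧
      (IsStationaryRM P planeFlow lineField ∧ IsStationaryRM P planeFlow lebesgueField) ∧
      (JointlyStationary P lineField lebesgueField ∧ JointlyErgodic P lineField lebesgueField) ∧
      -- both are diffuse with intensity 1
      (IsDiffuse P lineField ∧ IsDiffuse P lebesgueField) ∧
      (intensity P lineField = 1 ∧ intensity P lebesgueField = 1) ∧
      -- no allocation defined on the canonical space balances `ξ` and `η`
      ¬ ∃ τ : Config → (Fin 2 → ℝ) → OnePoint (Fin 2 → ℝ),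
        IsAllocation P planeFlow τ ∧ Balances P τ lineField lebesgueField := by
  refine ⟨exists_isPoissonProcess_canonicalN, fun P hP => ?_⟩
  have := hP.isProbabilityMeasure
  exact ⟨⟨isMeasurableFlow_planeFlow, isStationaryProb_planeFlow hP, isErgodicProb_planeFlow hP⟩,
    ⟨isRandomMeasure_lineField P, isRandomMeasure_lebesgueField P⟩,
    ⟨isStationaryRM_lineField P, isStationaryRM_lebesgueField P⟩,
    ⟨jointlyStationary_fields hP, jointlyErgodic_fields hP⟩,
    ⟨isDiffuse_lineField P, isDiffuse_lebesgueField P⟩,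
    ⟨intensity_lineField hP, intensity_lebesgueField⟩,
    not_exists_balancing_allocation⟩
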